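/- Let $G$ be a topological group and let $\ell^\infty(G)$ be the Banach algebra of bounded real functions on $G$. For $f\in\ell^\infty(G)$ and $g\in G$ put $(L_gf)(x)=f(gx)$. A mean on a linear subspace $F\subseteq\ell^\infty(G)$ is a linear functional $m:F\to\mathbb R$ with $\inf f\le m(f)\le\sup f$ for all $f\in F$; $F$ is left amenable if $L_gF\subseteq F$ for all $g\in G$ and there is a mean $m$ on $F$ with $m(L_gf)=m(f)$ for all $f\in F$ and $g\in G$. A compact $G$-system is a compact Hausdorff space $X$ with a jointly continuous action $G\times X\to X$. It is nonsensitive if for every entourage $\varepsilon$ of its unique compatible uniformity there is a nonempty open $O\subseteq X$ such that $(gx,gy)\in\varepsilon$ for all $g\in G$ and $x,y\in O$; it is hereditarily nonsensitive (HNS) if every nonempty closed $G$-invariant subset is nonsensitive as a $G$-system. A function $f:G\to\mathbb R$ is an Asplund function if there are an HNS compact $G$-system $X$, a continuous $F:X\to\mathbb R$ and a point $x_0\in X$ with $f(g)=F(gx_0)$ for all $g\in G$. Let $\mathrm{Asp}(G)\subseteq\ell^\infty(G)$ be the algebra of Asplund functions. Let $\mathrm{WAP}(G)\subseteq\ell^\infty(G)$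 be the space of weakly almost periodic functions, i.e. of the bounded continuous $f$ for which $\{L_gf:g\in G\}$ is relatively weakly compact. Then $\mathrm{Asp}(G)$ is left amenable. Moreover $\mathrm{WAP}(G)\subseteq\mathrm{Asp}(G)$, and $\mathrm{WAP}(G)$ is left amenable (Ryll-Nardzewski). -/

import Mathlib

open scoped Uniformity

universe u

namespace AsplundMean

/-! ### Bounded functions, means and left amenability -/

/-- The Banach algebra `ℓ^∞(G)` of bounded real functions on `G`, with the supremum norm. -/
abbrev LInf (G : Type u) : Type u := lp (fun _ : G => ℝ) (⊤ : ENNReal)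

/-- The left translate `x ↦ f (g * x)` of a bounded function `f`. -/
def leftTranslate {G : Type u} [Group G] (g : G) (f : LInf G) : LInf G :=
  ⟨fun x => f (g * x), memℓp_infty (by
    obtain ⟨C, hC⟩ := (lp.memℓp f).bddAbove
    exact ⟨C, by rintro _ ⟨x, rfl⟩; exact hC ⟨g * x, rfl⟩⟩)⟩

/-- A mean on a linear space `F` of bounded functions: a linear functional `m` with
`inf f ≤ m f ≤ sup f` for all `f ∈ F`. (If `F` contains the constants, this says that
`‖m‖ = m 1 = 1`.) -/
def IsMean {G : Type u} (F : Submodule ℝ (LInf G)) (m : F →ₗ[ℝ] ℝ) : Prop :=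
  ∀ f : F, (⨅ x : G, (f : LInf G) x) ≤ m f ∧ m f ≤ ⨆ x : G, (f : LInf G) x

/-- `F` is left amenable: it is invariant under left translations and it carries a left
invariant mean. -/
def IsLeftAmenable {G : Type u} [Group G] (F : Submodule ℝ (LInf G)) : Prop :=
  ∃ hF : ∀ (g : G), ∀ f ∈ F, leftTranslate g f ∈ F,
    ∃ m : F →ₗ[ℝ] ℝ, IsMean F m ∧
      ∀ (g : G) (f : F), m ⟨leftTranslate g f, hF g f f.2⟩ = m f

/-! ### Hereditarily nonsensitive systems -/

/-- The `G`-system `X` is nonsensitive: for every entourage `ε` there is a nonempty open set `O`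
such that every translate `g O` is `ε`-small. -/
def IsNonsensitive (G X : Type*) [SMul G X] [UniformSpace X] : Prop :=
  ∀ ε ∈ 𝓤 X, ∃ O : Set X, IsOpen O ∧ O.Nonempty ∧
    ∀ g : G, ∀ x ∈ O, ∀ y ∈ O, (g • x, g • y) ∈ ε

/-- The `G`-system `X` is hereditarily nonsensitive (HNS): every nonempty closed `G`-invariant
subset, as a `G`-system with the induced uniformity, is nonsensitive. -/
def IsHNS (G X : Type*) [SMul G X] [UniformSpace X] : Prop :=
  ∀ Z : SubMulAction G X, IsClosed (Z : Set X) → (Z : Set X).Nonempty → IsNonsensitive G Z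

/-- For a group action, HNS gives small relatively open pieces of all nonempty subsets,
invariant or not. -/
theorem IsHNS.exists_small {G X : Type*} [Group G] [MulAction G X] [UniformSpace X]
    [ContinuousConstSMul G X] (h : IsHNS G X) {A : Set X} (hA : A.Nonempty)
    {ε : Set (X × X)} (hε : ε ∈ 𝓤 X) :
    ∃ O : Set X, IsOpen O ∧ (O ∩ A).Nonempty ∧
      ∀ g : G, ∀ x ∈ O ∩ A, ∀ y ∈ O ∩ A, (g • x, g • y) ∈ ε := by
  let B : Set X := {y | ∃ g : G, ∃ a ∈ A, g • a = y}
  have hB : ∀ (g : G), ∀ x ∈ B, g • x ∈ B := by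
    rintro g _ ⟨k, a, ha, rfl⟩
    exact ⟨g * k, a, ha, mul_smul g k a⟩
  let Z : SubMulAction G X :=
    { carrier := closure B
      smul_mem' := fun g x hx =>
        map_mem_closure (continuous_const_smul g) hx (fun y hy => hB g y hy) }
  have hAB : A ⊆ B := fun a ha => ⟨1, a, ha, one_smul G a⟩
  have hAZ : ∀ a ∈ A, a ∈ Z := fun a ha => subset_closure (hAB ha)
  obtain ⟨a₀, ha₀⟩ := hA
  obtain ⟨O, hO, ⟨z, hz⟩, hsm⟩ := h Z isClosed_closure ⟨a₀, hAZ a₀ ha₀⟩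
    ((fun p : Z × Z => ((p.1 : X), (p.2 : X))) ⁻¹' ε)
    (by rw [uniformity_subtype]; exact Filter.preimage_mem_comap hε)
  obtain ⟨U, hU, rfl⟩ := isOpen_induced_iff.1 hO
  have hzB : (z : X) ∈ closure B := z.2
  obtain ⟨_, hyU, k, a, ha, rfl⟩ := mem_closure_iff.1 hzB U hU hz
  refine ⟨(fun x => k • x) ⁻¹' U, hU.preimage (continuous_const_smul k), ⟨a, hyU, ha⟩, ?_⟩
  rintro g x ⟨hxU, hx⟩ y ⟨hyU', hy⟩
  have := hsm (g * k⁻¹) ⟨k • x, Z.smul_mem k (hAZ x hx)⟩ hxU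
    ⟨k • y, Z.smul_mem k (hAZ y hy)⟩ hyU'
  simpa [mul_smul] using this

/-- A product of two HNS systems of a group is HNS. -/
theorem IsHNS.prod {G X Y : Type*} [Group G] [MulAction G X] [MulAction G Y]
    [UniformSpace X] [UniformSpace Y] [ContinuousConstSMul G X] [ContinuousConstSMul G Y]
    (hX : IsHNS G X) (hY : IsHNS G Y) : IsHNS G (X × Y) := by
  intro Z _ hne ε hε
  rw [uniformity_subtype, Filter.mem_comap] at hε
  obtain ⟨δ, hδ, hsub⟩ := hε
  rw [uniformity_prod_eq_prod, Filter.mem_map, Filter.mem_prod_iff] at hδ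
  obtain ⟨a, ha, b, hb, hab⟩ := hδ
  obtain ⟨O, hO, ⟨_, hpO, ⟨p, hp, rfl⟩⟩, hOs⟩ := hX.exists_small (hne.image Prod.fst) ha
  obtain ⟨V, hV, ⟨_, hqV, ⟨q, ⟨hqO, hq⟩, rfl⟩⟩, hVs⟩ := hY.exists_small
    (A := Prod.snd '' (Prod.fst ⁻¹' O ∩ (Z : Set (X × Y)))) ⟨p.2, p, ⟨hpO, hp⟩, rfl⟩ hb
  refine ⟨Subtype.val ⁻¹' (O ×ˢ V), (hO.prod hV).preimage continuous_subtype_val,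
    ⟨⟨q, hq⟩, hqO, hqV⟩, ?_⟩
  rintro g x ⟨hx1, hx2⟩ y ⟨hy1, hy2⟩
  apply hsub
  have h1 := hOs g _ ⟨hx1, x.1, x.2, rfl⟩ _ ⟨hy1, y.1, y.2, rfl⟩
  have h2 := hVs g _ ⟨hx2, x.1, ⟨hx1, x.2⟩, rfl⟩ _ ⟨hy2, y.1, ⟨hy1, y.2⟩, rfl⟩
  exact hab (a := ((g • x.1.1, g • y.1.1), (g • x.1.2, g • y.1.2))) ⟨h1, h2⟩

/-! ### Asplund functions -/

/-- `f : G → ℝ` is an Asplund function: there are a compact Hausdorff space `X` with a jointly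
continuous action of `G` that is HNS for its unique compatible uniformity, a continuous
`F : X → ℝ` and a point `x₀` with `f g = F (g • x₀)`. Such an `f` is automatically bounded and
continuous. There is no loss in taking `X` in the universe of `G`: one may replace `X` by the
closure of the orbit of `x₀`, a quotient of the space of ultrafilters on `G`. -/
def IsAsplund {G : Type u} [Group G] [TopologicalSpace G] (f : G → ℝ) : Prop :=
  ∃ (X : Type u) (_ : UniformSpace X) (_ : CompactSpace X) (_ : T2Space X)
    (_ : MulAction G X) (_ : ContinuousSMul G X),
    IsHNS G X ∧ ∃ (F : C(X, ℝ)) (x₀ : X), ∀ g : G, f g = F (g • x₀)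

theorem IsAsplund.const {G : Type u} [Group G] [TopologicalSpace G] (c : ℝ) :
    IsAsplund (fun _ : G => c) := by
  let _ : MulAction G PUnit.{u + 1} :=
    { smul := fun _ x => x, one_smul := fun _ => rfl, mul_smul := fun _ _ _ => rfl }
  refine ⟨PUnit.{u + 1}, inferInstance, inferInstance, inferInstance, inferInstance,
    ⟨continuous_of_const fun _ _ => rfl⟩, ?_, ContinuousMap.const _ c, PUnit.unit, fun _ => rfl⟩
  rintro Z _ ⟨z, hz⟩ ε hε
  exact ⟨Set.univ, isOpen_univ, ⟨⟨z, hz⟩, trivial⟩, fun g x _ y _ =>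
    (Subsingleton.elim (g • x) (g • y)) ▸ refl_mem_uniformity hε⟩

theorem IsAsplund.comp₂ {G : Type u} [Group G] [TopologicalSpace G] {f₁ f₂ : G → ℝ}
    (h₁ : IsAsplund f₁) (h₂ : IsAsplund f₂) (φ : C(ℝ × ℝ, ℝ)) :
    IsAsplund (fun g => φ (f₁ g, f₂ g)) := by
  obtain ⟨X, _, _, _, _, _, hX, F, x, hF⟩ := h₁
  obtain ⟨Y, _, _, _, _, _, hY, E, y, hE⟩ := h₂
  exact ⟨X × Y, inferInstance, inferInstance, inferInstance, inferInstance, inferInstance,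
    hX.prod hY, φ.comp ((F.comp ContinuousMap.fst).prodMk (E.comp ContinuousMap.snd)), (x, y),
    fun g => by simp [hF, hE]⟩

/-- `Asp(G)`, the algebra of Asplund functions, as a subalgebra of `ℓ^∞(G)`. -/
def Asp (G : Type u) [Group G] [TopologicalSpace G] : Subalgebra ℝ (LInf G) where
  carrier := {f | IsAsplund (f : G → ℝ)}
  mul_mem' h₁ h₂ := h₁.comp₂ h₂ ⟨fun p => p.1 * p.2, by fun_prop⟩
  add_mem' h₁ h₂ := h₁.comp₂ h₂ ⟨fun p => p.1 + p.2, by fun_prop⟩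
  algebraMap_mem' c := by
    have : ((algebraMap ℝ (LInf G) c : LInf G) : G → ℝ) = fun _ => c := by
      funext x
      simp [Algebra.algebraMap_eq_smul_one]
    change IsAsplund ((algebraMap ℝ (LInf G) c : LInf G) : G → ℝ)
    rw [this]
    exact IsAsplund.const c

/-! ### Weakly almost periodic functions -/

/-- The image of the orbit of `f` under left translations in `ℓ^∞(G)` with its weak topology. -/
def weakOrbit {G : Type u} [Group G] (f : LInf G) : Set (WeakSpace ℝ (LInf G)) :=
  Set.range fun g : G => toWeakSpace ℝ (LInf G) (leftTranslate g f)

/-- `f` is weakly almost periodic: it is continuous and its translates form a relatively weakly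
compact set. (The bounded continuous functions are a closed linear subspace of `ℓ^∞(G)`, hence
weakly closed, so relative weak compactness means the same in either space.) -/
def IsWAP {G : Type u} [Group G] [TopologicalSpace G] (f : LInf G) : Prop :=
  Continuous (f : G → ℝ) ∧ IsCompact (closure (weakOrbit f))

/-- `WAP(G)`, the space of weakly almost periodic functions, as a subspace of `ℓ^∞(G)`. -/
def WAP (G : Type u) [Group G] [TopologicalSpace G] : Submodule ℝ (LInf G) where
  carrier := {f | IsWAP f}
  zero_mem' := by
    refine ⟨continuous_const, (isCompact_singleton (x := 0)).closure_of_subset ?_⟩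
    rintro _ ⟨g, rfl⟩
    rfl
  add_mem' := by
    rintro f₁ f₂ ⟨hc₁, hk₁⟩ ⟨hc₂, hk₂⟩
    refine ⟨hc₁.add hc₂, ((hk₁.prod hk₂).image continuous_add).closure_of_subset ?_⟩
    rintro _ ⟨g, rfl⟩
    exact ⟨(toWeakSpace ℝ (LInf G) (leftTranslate g f₁),
      toWeakSpace ℝ (LInf G) (leftTranslate g f₂)),
      ⟨subset_closure ⟨g, rfl⟩, subset_closure ⟨g, rfl⟩⟩, rfl⟩
  smul_mem' := by
    rintro c f ⟨hc, hk⟩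
    refine ⟨hc.const_smul c, (hk.image (continuous_const_smul c)).closure_of_subset ?_⟩
    rintro _ ⟨g, rfl⟩
    exact ⟨toWeakSpace ℝ (LInf G) (leftTranslate g f), subset_closure ⟨g, rfl⟩, rfl⟩

end AsplundMean

namespace AsplundMean

/-! ### Invariant states of equicontinuous actions -/

/-! Amenability comes from equicontinuity. In a minimal system every orbit is dense, so a single
nonempty open set with uniformly small translates can be carried by the group to a neighbourhood of
any point: a minimal subset of a product of HNS systems is equicontinuous
(`equicontinuous_of_minimal`). An equicontinuous action on a compact space has an invariant state,
built without Haar measure. A smallest finite net for an invariant relation is matched with each of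
its translates by Hall's marriage theorem, so averaging over it is almost invariant, and an
ultrafilter limit is invariant. Taking the product of one system for each function in the space,
with its base point, gives one state that treats all the functions at once. It lives on the orbit
closure of the base point, which gives linearity of the mean and the bounds by `inf` and `sup`.

For a weakly almost periodic `f` the HNS system is the pointwise closure of the right translates of
`f`. Weak compactness of the left orbit makes evaluation extend to a separately continuous function
on the product of this hull and the weak closure of the left orbit. Such functions have small
oscillation on some nonempty open set, uniformly in the other variable
(`exists_isOpen_small_oscillation`). Otherwise a Cantor scheme would yield uncountably many points
separated by `ε` on a countable set of parameters, against separability. Applied with either factor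
in the first place, this gives both nonsensitivity and joint continuity of the action. -/

/-- A net of minimal cardinality for an invariant relation is matched with each of its translates. -/
theorem exists_almost_invariant_net {G Y : Type*} [Group G] [MulAction G Y]
    {U : Set (Y × Y)} (hinv : ∀ (g : G) (x y : Y), (x, y) ∈ U → (g • x, g • y) ∈ U)
    (hnet : ∃ t : Finset Y, ∀ y, ∃ z ∈ t, (y, z) ∈ U) :
    ∃ t : Finset Y, (∀ y, ∃ z ∈ t, (y, z) ∈ U) ∧ ∀ g : G, ∃ σ : Equiv.Perm t,
      ∀ z : t, ∃ y, (y, g • (z : Y)) ∈ U ∧ (y, (σ z : Y)) ∈ U := by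
  classical
  let P : ℕ → Prop := fun n => ∃ t : Finset Y, t.card = n ∧ ∀ y, ∃ z ∈ t, (y, z) ∈ U
  have hP : ∃ n, P n := by
    obtain ⟨t, ht⟩ := hnet
    exact ⟨_, t, rfl, ht⟩
  obtain ⟨t, htn, ht⟩ := Nat.find_spec hP
  have hmin : ∀ s : Finset Y, (∀ y, ∃ z ∈ s, (y, z) ∈ U) → t.card ≤ s.card := fun s hs => by
    rw [htn]
    exact Nat.find_min' hP ⟨s, rfl, hs⟩
  refine ⟨t, ht, fun g => ?_⟩
  let N : t → Finset t := fun z => {w | ∃ y, (y, g • (z : Y)) ∈ U ∧ (y, (w : Y)) ∈ U}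
  -- Hall's condition. The points of `g • (t \ I)` together with `N(I)` again form a net: if `y` is
  -- close to `g • z` with `z ∈ I`, then any `w ∈ t` close to `y` lies in `N z`. Minimality gives
  -- `|t| ≤ |t| - |I| + |N(I)|`.
  have hall : ∀ I : Finset t, I.card ≤ (I.biUnion N).card := by
    intro I
    have h1 := hmin (((Iᶜ).image fun z : t => g • (z : Y)) ∪ (I.biUnion N).image Subtype.val) (by
      intro y
      obtain ⟨z, hz, hyz⟩ := ht (g⁻¹ • y)
      obtain ⟨w, hw, hyw⟩ := ht y
      have hyz' : (y, g • z) ∈ U := by simpa using hinv g _ _ hyz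
      by_cases hI : (⟨z, hz⟩ : t) ∈ I
      · refine ⟨w, Finset.mem_union_right _ (Finset.mem_image.2 ⟨⟨w, hw⟩, ?_, rfl⟩), hyw⟩
        exact Finset.mem_biUnion.2 ⟨_, hI, by simpa [N] using ⟨y, hyz', hyw⟩⟩
      · exact ⟨g • z, Finset.mem_union_left _
          (Finset.mem_image.2 ⟨⟨z, hz⟩, by simpa using hI, rfl⟩), hyz'⟩)
    have h2 := Finset.card_union_le ((Iᶜ).image fun z : t => g • (z : Y))
      ((I.biUnion N).image Subtype.val)
    have h3 := Finset.card_image_le (s := Iᶜ) (f := fun z : t => g • (z : Y))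
    have h4 := Finset.card_image_le (s := I.biUnion N) (f := Subtype.val)
    have h5 := Finset.card_add_card_compl I
    rw [Fintype.card_coe] at h5
    omega
  obtain ⟨σ, hσ, hσN⟩ := (Finset.all_card_le_biUnion_card_iff_exists_injective N).1 hall
  refine ⟨Equiv.ofBijective σ (Finite.injective_iff_bijective.1 hσ), fun z => ?_⟩
  simpa [N] using hσN z

open Filter Topology in
/-- An equicontinuous action on a nonempty compact space has an invariant state. -/
theorem exists_invariant_state {G Y : Type*} [Group G] [MulAction G Y] [UniformSpace Y]
    [CompactSpace Y] [Nonempty Y] [ContinuousConstSMul G Y]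
    (heq : UniformEquicontinuous fun (g : G) (y : Y) => g • y) :
    ∃ μ : C(Y, ℝ) →ₗ[ℝ] ℝ, (∀ F, 0 ≤ F → 0 ≤ μ F) ∧ μ 1 = 1 ∧
      ∀ (g : G) (F : C(Y, ℝ)), μ (F.comp ⟨fun y => g • y, continuous_const_smul g⟩) = μ F := by
  classical
  have happrox : ∀ i : Finset C(Y, ℝ) × ℕ, ∃ μ : C(Y, ℝ) →ₗ[ℝ] ℝ, (∀ F, 0 ≤ F → 0 ≤ μ F) ∧
      μ 1 = 1 ∧ ∀ (g : G), ∀ F ∈ i.1,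
        |μ (F.comp ⟨fun y => g • y, continuous_const_smul g⟩) - μ F| ≤ 1 / ((i.2 : ℝ) + 1) := by
    rintro ⟨s, n⟩
    have hn : (0 : ℝ) < 1 / ((n : ℝ) + 1) := by positivity
    have hV : {p : Y × Y | ∀ F ∈ s, dist (F p.1) (F p.2) < 1 / ((n : ℝ) + 1)} ∈ 𝓤 Y := by
      have : ∀ F ∈ s, ∀ᶠ p in 𝓤 Y, dist (F p.1) (F p.2) < 1 / ((n : ℝ) + 1) := fun F _ =>
        CompactSpace.uniformContinuous_of_continuous F.continuous (Metric.dist_mem_uniformity hn)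
      exact (eventually_all_finset s).2 this
    obtain ⟨W, hW, hWs, hWV⟩ := comp_symm_mem_uniformity_sets hV
    -- The largest invariant relation inside `W` is still an entourage, by equicontinuity, so total
    -- boundedness supplies a finite net.
    obtain ⟨t, ht, hσ⟩ := exists_almost_invariant_net (G := G)
      (U := {p : Y × Y | ∀ g : G, (g • p.1, g • p.2) ∈ W})
      (fun g x y h k => by simpa [mul_smul] using h (k * g)) (by
        obtain ⟨t, -, htf, htc⟩ := isCompact_univ.totallyBounded.exists_subset (heq W hW)
        refine ⟨htf.toFinset, fun y => ?_⟩
        simpa using htc (Set.mem_univ y))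
    have htn : (0 : ℝ) < t.card := by
      obtain ⟨z, hz, -⟩ := ht (Classical.arbitrary Y)
      exact_mod_cast Finset.card_pos.2 ⟨z, hz⟩
    refine ⟨(t.card : ℝ)⁻¹ • ∑ z : t,
      (ContinuousMap.evalCLM ℝ (z : Y) : C(Y, ℝ) →L[ℝ] ℝ).toLinearMap, ?_, ?_, ?_⟩
    · intro F hF
      simp only [LinearMap.smul_apply, LinearMap.sum_apply, smul_eq_mul]
      exact mul_nonneg (by positivity) (Finset.sum_nonneg fun z _ => hF z)
    · simp [htn.ne']
    · intro g F hF
      obtain ⟨σ, hσ⟩ := hσ g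
      -- Both `g • z` and `σ z` are `W`-close to a common `y`, and `W ○ W` lies within the common
      -- modulus of the functions in `s`.
      have hz : ∀ z : t, |F (g • (z : Y)) - F (σ z)| ≤ 1 / ((n : ℝ) + 1) := fun z => by
        obtain ⟨y, h1, h2⟩ := hσ z
        have h1' := hWs.symm _ _ (by simpa using h1 1)
        have h2' : (y, (σ z : Y)) ∈ W := by simpa using h2 1
        have := hWV (SetRel.prodMk_mem_comp h1' h2') F hF
        exact this.le
      have hsum : ∑ z : t, F z = ∑ z : t, F (σ z) := (Equiv.sum_comp σ fun z : t => F z).symm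
      simp only [LinearMap.smul_apply, LinearMap.sum_apply, smul_eq_mul,
        ContinuousLinearMap.coe_coe, ContinuousMap.evalCLM_apply, ContinuousMap.comp_apply,
        ContinuousMap.coe_mk]
      rw [hsum, ← mul_sub, ← Finset.sum_sub_distrib, abs_mul, abs_of_pos (inv_pos.2 htn),
        inv_mul_le_iff₀ htn]
      refine (Finset.abs_sum_le_sum_abs _ _).trans ?_
      simpa using Finset.sum_le_sum fun z (_ : z ∈ Finset.univ) => hz z
  choose ν hpos hone hinv using happrox
  have hbd : ∀ i F, ν i F ∈ Set.Icc (-‖F‖) ‖F‖ := by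
    intro i F
    have h1 := hpos i (F + ‖F‖ • 1) fun y => by
      have := (abs_le.1 (F.norm_coe_le_norm y)).1
      simp; linarith
    have h2 := hpos i (‖F‖ • 1 - F) fun y => by
      have := (abs_le.1 (F.norm_coe_le_norm y)).2
      simp; linarith
    simp only [map_add, map_sub, map_smul, hone, smul_eq_mul, mul_one] at h1 h2
    constructor <;> linarith
  -- Along `atTop` every `F` eventually belongs to the finite set and the error `1 / (n + 1)` tends
  -- to zero. An ultrafilter makes all the bounded values converge simultaneously.
  let 𝒰 : Ultrafilter (Finset C(Y, ℝ) × ℕ) := Ultrafilter.of atTop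
  have hlim : ∀ F, ∃ a, Tendsto (fun i => ν i F) 𝒰 (𝓝 a) := fun F => by
    obtain ⟨a, -, ha⟩ := isCompact_Icc.ultrafilter_le_nhds (𝒰.map fun i => ν i F)
      (le_principal_iff.2 (Filter.mem_map.2 (univ_mem' fun i => hbd i F)))
    exact ⟨a, ha⟩
  choose μ hμ using hlim
  refine ⟨{ toFun := μ, map_add' := fun F E => ?_, map_smul' := fun c F => ?_ }, ?_, ?_, ?_⟩
  · refine tendsto_nhds_unique (hμ _) ?_
    simpa using (hμ F).add (hμ E)
  · refine tendsto_nhds_unique (hμ _) ?_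
    simpa using (hμ F).const_mul c
  · intro F hF
    exact ge_of_tendsto' (hμ F) fun i => hpos i F hF
  · refine tendsto_nhds_unique (hμ _) ?_
    simp [hone]
  · intro g F
    have h0 : Tendsto (fun i : Finset C(Y, ℝ) × ℕ => 1 / ((i.2 : ℝ) + 1)) 𝒰 (𝓝 0) :=
      (tendsto_one_div_add_atTop_nhds_zero_nat.comp
        (tendsto_snd.mono_left prod_atTop_atTop_eq.ge)).mono_left (Ultrafilter.of_le _)
    have h1 : ∀ᶠ i in (𝒰 : Filter (Finset C(Y, ℝ) × ℕ)), F ∈ i.1 :=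
      Ultrafilter.of_le _ <| (eventually_ge_atTop ({F}, 0)).mono fun i hi =>
        hi.1 (Finset.mem_singleton_self F)
    exact sub_eq_zero.1 (tendsto_nhds_unique ((hμ _).sub (hμ F))
      (squeeze_zero_norm' (h1.mono fun i hi => hinv i g F hi) h0))

/-! ### Minimal subsystems of HNS systems -/

/-- A nonempty closed invariant subset of a compact system contains a minimal one. -/
theorem exists_minimal_subMulAction {G X : Type*} [Group G] [MulAction G X] [TopologicalSpace X]
    [CompactSpace X] (Z : SubMulAction G X) (hZ : IsClosed (Z : Set X))
    (hne : (Z : Set X).Nonempty) :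
    ∃ Y : SubMulAction G X, Y ≤ Z ∧ IsClosed (Y : Set X) ∧ (Y : Set X).Nonempty ∧
      ∀ W : SubMulAction G X, W ≤ Y → IsClosed (W : Set X) → (W : Set X).Nonempty → W = Y := by
  let S : Set (Set X) := {s | IsClosed s ∧ s.Nonempty ∧ ∀ (g : G), ∀ x ∈ s, g • x ∈ s}
  obtain ⟨Y, hYZ, hY⟩ := zorn_superset_nonempty S (fun c hc hchain hcne => by
    refine ⟨⋂₀ c, ⟨isClosed_sInter fun s hs => (hc hs).1, ?_, fun g x hx s hs =>
      (hc hs).2.2 g x (hx s hs)⟩, fun s hs => Set.sInter_subset_of_mem hs⟩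
    have : Nonempty c := hcne.to_subtype
    rw [Set.sInter_eq_iInter]
    exact IsCompact.nonempty_iInter_of_directed_nonempty_isCompact_isClosed _
      (directedOn_iff_directed.1 fun a ha b hb => (hchain.total ha hb).elim
        (fun h => ⟨a, ha, subset_rfl, h⟩) fun h => ⟨b, hb, h, subset_rfl⟩) (fun s => (hc s.2).2.1)
      (fun s => (hc s.2).1.isCompact) (fun s => (hc s.2).1))
    (Z : Set X) ⟨hZ, hne, fun g x hx => Z.smul_mem g hx⟩
  refine ⟨⟨Y, fun g x hx => hY.prop.2.2 g x hx⟩, hYZ, hY.prop.1, hY.prop.2.1, fun W hW hc hn => ?_⟩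
  exact SetLike.coe_injective (hY.eq_of_subset ⟨hc, hn, fun g x hx => W.smul_mem g hx⟩ hW)

/-- The closure of an orbit, as an invariant set. -/
def orbitClosure (G : Type*) {X : Type*} [Group G] [MulAction G X] [TopologicalSpace X]
    [ContinuousConstSMul G X] (x : X) : SubMulAction G X where
  carrier := closure (MulAction.orbit G x)
  smul_mem' g y hy := map_mem_closure (continuous_const_smul g) hy (by
    rintro _ ⟨h, rfl⟩
    exact ⟨g * h, mul_smul g h x⟩)

/-- A minimal subset of a product of HNS systems is equicontinuous. -/
theorem equicontinuous_of_minimal {G ι : Type*} {X : ι → Type*} [Group G]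
    [∀ i, UniformSpace (X i)] [∀ i, MulAction G (X i)] [∀ i, ContinuousConstSMul G (X i)]
    (hX : ∀ i, IsHNS G (X i)) (Y : SubMulAction G (∀ i, X i)) (hYc : IsClosed (Y : Set (∀ i, X i)))
    (hY : ∀ W : SubMulAction G (∀ i, X i), W ≤ Y → IsClosed (W : Set (∀ i, X i)) →
      (W : Set (∀ i, X i)).Nonempty → W = Y) :
    Equicontinuous fun (g : G) (y : Y) => g • y := by
  -- One coordinate at a time: the HNS property is applied to the projection of `Y`, so HNS of the
  -- infinite product is never needed.
  have key : ∀ i, Equicontinuous fun (g : G) (y : Y) => (g • y : Y).1 i := by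
    intro i y₀ ε hε
    obtain ⟨O, hO, ⟨_, hzO, z, hz, rfl⟩, hOs⟩ := (hX i).exists_small
      (A := Function.eval i '' (Y : Set (∀ i, X i))) ⟨_, y₀.1, y₀.2, rfl⟩ hε
    have hle : orbitClosure G y₀.1 ≤ Y := closure_minimal (by
      rintro _ ⟨g, rfl⟩
      exact Y.smul_mem g y₀.2) hYc
    have hz' : z ∈ closure (MulAction.orbit G y₀.1) := by
      have := hY _ hle isClosed_closure ⟨y₀.1, subset_closure (MulAction.mem_orbit_self _)⟩
      rw [← this] at hz
      exact hz
    -- By minimality the orbit of `y₀` enters the small set, at `h • y₀`. Since smallness holds for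
    -- all translates, pulling back by `h` costs nothing.
    obtain ⟨_, hgO, h, rfl⟩ := mem_closure_iff.1 hz' _ (hO.preimage (continuous_apply i)) hzO
    have hnhds : {y : Y | (h • y : Y).1 i ∈ O} ∈ nhds y₀ := by
      refine IsOpen.mem_nhds (hO.preimage ?_) hgO
      exact (continuous_const_smul h).comp ((continuous_apply i).comp continuous_subtype_val)
    filter_upwards [hnhds] with y hy g
    have := hOs (g * h⁻¹) _ ⟨hgO, _, (h • y₀ : Y).2, rfl⟩ _ ⟨hy, _, (h • y).2, rfl⟩
    simpa [mul_smul] using this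
  intro y₀
  have : EquicontinuousAt (fun (g : G) (y : Y) => (g • y : Y).1) y₀ := by
    rw [Pi.uniformSpace_eq, equicontinuousAt_iInf_rng]
    intro i
    exact (@IsUniformInducing.equicontinuousAt_iff _ _ _ _ _
      (UniformSpace.comap (Function.eval i) inferInstance) _ _ _ (Function.eval i)
      (@IsUniformInducing.mk _ _ (UniformSpace.comap _ _) _ _ rfl)).2 (key i y₀)
  exact (isUniformEmbedding_subtype_val.isUniformInducing.equicontinuousAt_iff).2 this

/-- A product of HNS compact systems has an invariant state supported by the closure of any given
orbit. -/
theorem exists_invariant_state_of_isHNS {G ι : Type*} {X : ι → Type*} [Group G]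
    [∀ i, UniformSpace (X i)] [∀ i, CompactSpace (X i)] [∀ i, MulAction G (X i)]
    [∀ i, ContinuousConstSMul G (X i)] (hX : ∀ i, IsHNS G (X i)) (x₀ : ∀ i, X i) :
    ∃ μ : C(∀ i, X i, ℝ) →ₗ[ℝ] ℝ, (∀ F, (∀ g : G, 0 ≤ F (g • x₀)) → 0 ≤ μ F) ∧ μ 1 = 1 ∧
      ∀ (g : G) (F : C(∀ i, X i, ℝ)),
        μ (F.comp ⟨fun y => g • y, continuous_const_smul g⟩) = μ F := by
  obtain ⟨Y, hYZ, hYc, hYne, hY⟩ := exists_minimal_subMulAction (orbitClosure G x₀)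
    isClosed_closure ⟨x₀, subset_closure (MulAction.mem_orbit_self _)⟩
  have : CompactSpace Y := isCompact_iff_compactSpace.1 hYc.isCompact
  have : Nonempty Y := hYne.to_subtype
  have : ContinuousConstSMul G Y :=
    ⟨fun g => ((continuous_const_smul g).comp continuous_subtype_val).subtype_mk _⟩
  obtain ⟨μ, hpos, hone, hinv⟩ := exists_invariant_state (G := G)
    (CompactSpace.uniformEquicontinuous_of_equicontinuous (equicontinuous_of_minimal hX Y hYc hY))
  let ρ : C(Y, ∀ i, X i) := ⟨Subtype.val, continuous_subtype_val⟩
  refine ⟨{ toFun := fun F => μ (F.comp ρ)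
            map_add' := fun F E => map_add μ (F.comp ρ) (E.comp ρ)
            map_smul' := fun c F => map_smul μ c (F.comp ρ) }, fun F hF => ?_, ?_, fun g F => ?_⟩
  · refine hpos _ fun y => ?_
    have hcl : closure (MulAction.orbit G x₀) ⊆ {x | 0 ≤ F x} := closure_minimal (by
      rintro _ ⟨g, rfl⟩
      exact hF g) (isClosed_le continuous_const F.continuous)
    exact hcl (hYZ y.2)
  · exact hone
  · exact hinv g (F.comp ρ)

/-! ### Left amenability of spaces of Asplund functions -/

theorem IsAsplund.leftTranslate {G : Type u} [Group G] [TopologicalSpace G] {f : LInf G}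
    (hf : IsAsplund (f : G → ℝ)) (g : G) : IsAsplund (leftTranslate g f : G → ℝ) := by
  obtain ⟨X, _, _, _, _, _, hX, F, x, hF⟩ := hf
  exact ⟨X, inferInstance, inferInstance, inferInstance, inferInstance, inferInstance, hX,
    F.comp ⟨fun y => g • y, continuous_const_smul g⟩, x, fun h =>
      (hF (g * h)).trans (by simp [mul_smul])⟩

/-- A mean on `Asp(G)` could be restricted, but the argument works directly on any invariant
subspace: each `f` is read off from its own coordinate of the product of all the chosen systems. -/
theorem isLeftAmenable_of_le_asp {G : Type u} [Group G] [TopologicalSpace G]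
    {E : Submodule ℝ (LInf G)} (hE : E ≤ Subalgebra.toSubmodule (Asp G))
    (hinv : ∀ (g : G), ∀ f ∈ E, leftTranslate g f ∈ E) : IsLeftAmenable E := by
  have hA : ∀ f : E, IsAsplund ((f : LInf G) : G → ℝ) := fun f => hE f.2
  choose X uX cX tX aX sX hX F x₀ hF using hA
  obtain ⟨μ, hpos, hone, hμ⟩ := exists_invariant_state_of_isHNS hX x₀
  let Φ : E → C(∀ f, X f, ℝ) := fun f => (F f).comp ⟨fun y => y f, continuous_apply f⟩
  have hΦ : ∀ f g, Φ f (g • x₀) = (f : LInf G) g := fun f g => (hF f g).symm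
  have hle : ∀ A B : C(∀ f, X f, ℝ), (∀ g : G, A (g • x₀) ≤ B (g • x₀)) → μ A ≤ μ B :=
    fun A B h => by
      have := hpos (B - A) fun g => by simpa using h g
      rw [map_sub] at this
      linarith
  -- The choice of systems is arbitrary, so `Φ` is not linear. It is linear along the orbit of `x₀`,
  -- and `μ` sees nothing else.
  have heq : ∀ A B : C(∀ f, X f, ℝ), (∀ g : G, A (g • x₀) = B (g • x₀)) → μ A = μ B :=
    fun A B h => le_antisymm (hle A B fun g => (h g).le) (hle B A fun g => (h g).ge)
  have hconst : ∀ c : ℝ, μ (c • 1) = c := fun c => by simp [hone]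
  refine ⟨hinv, { toFun := fun f => μ (Φ f)
                  map_add' := fun f h => ?_
                  map_smul' := fun c f => ?_ }, fun f => ?_, fun g f => ?_⟩
  · rw [← map_add]
    exact heq _ _ fun g => by simp [hΦ]
  · rw [RingHom.id_apply, ← map_smul]
    exact heq _ _ fun g => by simp [hΦ]
  · obtain ⟨C, hC⟩ := (lp.memℓp (f : LInf G)).bddAbove
    have hb : ∀ g, |(f : LInf G) g| ≤ C := fun g => hC ⟨g, rfl⟩
    constructor
    · rw [← hconst (⨅ x, (f : LInf G) x)]
      refine hle _ _ fun g => ?_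
      simpa [hΦ] using ciInf_le ⟨-C, by rintro _ ⟨g, rfl⟩; exact (abs_le.1 (hb g)).1⟩ g
    · rw [← hconst (⨆ x, (f : LInf G) x)]
      refine hle _ _ fun g => ?_
      simpa [hΦ] using le_ciSup (f := fun x => (f : LInf G) x)
        ⟨C, by rintro _ ⟨g, rfl⟩; exact (abs_le.1 (hb g)).2⟩ g
  · change μ (Φ _) = μ (Φ f)
    rw [← hμ g (Φ f)]
    refine heq _ _ fun h => ?_
    simp only [hΦ, ContinuousMap.comp_apply, ContinuousMap.coe_mk, ← mul_smul]
    rfl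

/-! ### Separately continuous functions on products of compact spaces -/

/-- For a separately continuous function `Φ` on a product of compact spaces and a countable family
`d` of points of the second factor, the functions `Φ x ∘ d` form a separable set for the uniform
distance. -/
theorem exists_countable_approx {X K D : Type*} [TopologicalSpace X] [CompactSpace X]
    [TopologicalSpace K] [CompactSpace K] [Countable D] {Φ : X → K → ℝ}
    (h₁ : ∀ k, Continuous fun x => Φ x k) (h₂ : ∀ x, Continuous (Φ x)) (d : D → K)
    {ε : ℝ} (hε : 0 < ε) :
    ∃ c : X → ℕ, ∀ x y, c x = c y → ∀ i, |Φ x (d i) - Φ y (d i)| < ε := by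
  let a : X → D → ℝ := fun x i => Φ x (d i)
  have ha : Continuous a := continuous_pi fun i => h₁ (d i)
  have hq : Topology.IsQuotientMap (Set.rangeFactorization a) :=
    IsClosedMap.isQuotientMap
      (Continuous.isClosedMap (ha.subtype_mk _)) (ha.subtype_mk _)
      Set.rangeFactorization_surjective
  -- `Set.range a` lies in the separable metrizable space `D → ℝ`, as `D` is countable.
  obtain ⟨S, hSc, hSd⟩ := TopologicalSpace.exists_countable_dense (Set.range a)
  let r : Set.range a → X := fun y => y.2.choose
  have hr : ∀ y, a (r y) = y := fun y => y.2.choose_spec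
  let K' : Set K := closure (Set.range d)
  -- a function `Φ · k` with `k` in the closure of the countable family factors through `a`
  have hfac : ∀ k ∈ K', ∀ x y, a x = a y → Φ x k = Φ y k := by
    intro k hk x y hxy
    have : K' ⊆ {k | Φ x k = Φ y k} := closure_minimal (by
      rintro _ ⟨i, rfl⟩
      exact congrFun hxy i) (isClosed_eq (h₂ x) (h₂ y))
    exact this hk
  have hcont : ∀ k ∈ K', Continuous fun y : Set.range a => Φ (r y) k := by
    intro k hk
    rw [hq.continuous_iff]
    convert h₁ k using 1
    funext x
    exact hfac k hk _ _ (hr _)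
  have : Countable S := hSc.to_subtype
  have : CompactSpace K' := isCompact_iff_compactSpace.1 isClosed_closure.isCompact
  -- A point of `K'` acts as a continuous function on `Set.range a`, hence is determined by its
  -- values on `S`. So every `Φ x` descends to the compact metrizable space `Set.range b`, whose
  -- space of continuous functions is separable; `c x` is the index of a nearby term of a dense
  -- sequence there.
  let b : K' → S → ℝ := fun k s => Φ (r s) k
  have hb : Continuous b := continuous_pi fun s => (h₂ _).comp continuous_subtype_val
  have hbq : Topology.IsQuotientMap (Set.rangeFactorization b) :=
    IsClosedMap.isQuotientMap
      (Continuous.isClosedMap (hb.subtype_mk _)) (hb.subtype_mk _)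
      Set.rangeFactorization_surjective
  have hbfac : ∀ (x : X) (k l : K'), b k = b l → Φ x k = Φ x l := by
    intro x k l hkl
    have h := (hcont k k.2).ext_on hSd (hcont l l.2) fun s hs => congrFun hkl ⟨s, hs⟩
    have hx := congrFun h ⟨a x, x, rfl⟩
    have e := hr ⟨a x, x, rfl⟩
    rw [← hfac k k.2 _ _ e, ← hfac l l.2 _ _ e]
    exact hx
  let r' : Set.range b → K' := fun y => y.2.choose
  have hr' : ∀ y, b (r' y) = y := fun y => y.2.choose_spec
  have : CompactSpace (Set.range b) :=
    isCompact_iff_compactSpace.1 (isCompact_range hb)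
  let Ψ : X → C(Set.range b, ℝ) := fun x => ⟨fun y => Φ x (r' y), by
    rw [hbq.continuous_iff]
    convert (h₂ x).comp (continuous_subtype_val (p := (· ∈ K'))) using 1
    funext k
    exact hbfac x _ _ (hr' _)⟩
  have hΨ : ∀ x (k : K'), Ψ x ⟨b k, k, rfl⟩ = Φ x k := fun x k => hbfac x _ _ (hr' _)
  have hden : ∀ x, ∃ n : ℕ, dist (Ψ x) (TopologicalSpace.denseSeq C(Set.range b, ℝ) n) < ε / 2 :=
    fun x => by
      obtain ⟨_, h, n, rfl⟩ := Metric.dense_iff.1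
        (TopologicalSpace.denseRange_denseSeq C(Set.range b, ℝ)) (Ψ x) (ε / 2) (half_pos hε)
      exact ⟨n, by rwa [dist_comm]⟩
  choose c hc using hden
  refine ⟨c, fun x y hxy i => ?_⟩
  have hd : dist (Ψ x) (Ψ y) < ε := by
    have h1 := hc x
    have h2 := hc y
    rw [hxy] at h1
    have := dist_triangle_right (Ψ x) (Ψ y) (TopologicalSpace.denseSeq C(Set.range b, ℝ) (c y))
    linarith
  have hdi := (ContinuousMap.dist_apply_le_dist (f := Ψ x) (g := Ψ y)
    ⟨b ⟨d i, subset_closure ⟨i, rfl⟩⟩, _, rfl⟩).trans_lt hd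
  rwa [hΨ, hΨ, Real.dist_eq] at hdi

/-- A separately continuous function on a product of compact spaces oscillates little on some open
subset of the first factor, uniformly over the second one. -/
theorem exists_isOpen_small_oscillation {X K : Type*} [TopologicalSpace X] [CompactSpace X]
    [RegularSpace X] [Nonempty X] [TopologicalSpace K] [CompactSpace K] {Φ : X → K → ℝ}
    (h₁ : ∀ k, Continuous fun x => Φ x k) (h₂ : ∀ x, Continuous (Φ x)) {ε : ℝ} (hε : 0 < ε) :
    ∃ O : Set X, IsOpen O ∧ O.Nonempty ∧ ∀ x ∈ O, ∀ y ∈ O, ∀ k, |Φ x k - Φ y k| ≤ ε := by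
  by_contra! hcon
  let 𝒪 : Type _ := {O : Set X // IsOpen O ∧ O.Nonempty}
  have hsplit : ∀ O : 𝒪, ∃ (k : K) (P : Bool → 𝒪), (∀ i, closure (P i).1 ⊆ O.1) ∧
      ∀ x ∈ closure (P false).1, ∀ y ∈ closure (P true).1, ε < |Φ x k - Φ y k| := by
    rintro ⟨O, hO, hne⟩
    obtain ⟨x, hx, y, hy, k, hk⟩ := hcon O hO hne
    have hkc : IsOpen {p : X × X | ε < |Φ p.1 k - Φ p.2 k|} :=
      isOpen_lt continuous_const
        (((h₁ k).comp continuous_fst).sub ((h₁ k).comp continuous_snd)).abs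
    obtain ⟨U, V, hU, hV, hxU, hyV, hUV⟩ := isOpen_prod_iff.1 hkc x y hk
    have hsh : ∀ (z : X) (W : Set X), IsOpen W → z ∈ W →
        ∃ P : 𝒪, closure P.1 ⊆ W := fun z W hW hz => by
      obtain ⟨C, hC, hCc, hCW⟩ := exists_mem_nhds_isClosed_subset (hW.mem_nhds hz)
      exact ⟨⟨interior C, isOpen_interior, z, mem_interior_iff_mem_nhds.2 hC⟩,
        (closure_minimal interior_subset hCc).trans hCW⟩
    obtain ⟨P, hP⟩ := hsh x (O ∩ U) (hO.inter hU) ⟨hx, hxU⟩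
    obtain ⟨Q, hQ⟩ := hsh y (O ∩ V) (hO.inter hV) ⟨hy, hyV⟩
    refine ⟨k, fun i => bif i then Q else P, ?_, fun x hx y hy => ?_⟩
    · rintro (_ | _)
      · exact hP.trans Set.inter_subset_left
      · exact hQ.trans Set.inter_subset_left
    · exact hUV (Set.mk_mem_prod (hP hx).2 (hQ hy).2)
  choose k P hPO hPk using hsplit
  -- A binary tree of open sets. Lists carry the latest choice first, so `br σ n` is the reversed
  -- initial segment of `σ` of length `n`.
  let T : List Bool → 𝒪 := fun l => l.rec ⟨Set.univ, isOpen_univ, Set.univ_nonempty⟩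
    fun i _ O => P O i
  let br : (ℕ → Bool) → ℕ → List Bool := fun σ n => n.rec [] fun n l => σ n :: l
  have hx : ∀ σ, ∃ x, ∀ n, x ∈ closure (T (br σ n)).1 := fun σ => by
    obtain ⟨x, hx⟩ := IsCompact.nonempty_iInter_of_sequence_nonempty_isCompact_isClosed
      (fun n => closure (T (br σ n)).1)
      (fun n => (hPO (T (br σ n)) (σ n)).trans subset_closure)
      (fun n => (T (br σ n)).2.2.closure) isClosed_closure.isCompact fun n => isClosed_closure
    exact ⟨x, Set.mem_iInter.1 hx⟩
  choose x hx using hx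
  obtain ⟨c, hc⟩ := exists_countable_approx h₁ h₂ (fun l => k (T l)) hε
  -- Two branches part at a first node; there the parameter `k` attached to the node separates their
  -- points by more than `ε`, while equal labels would keep them within `ε`.
  have hinj : Function.Injective fun σ => c (x σ) := by
    intro σ τ hστ
    by_contra hne
    have hex : ∃ n, σ n ≠ τ n := Function.ne_iff.1 hne
    classical
    let n := Nat.find hex
    have hlt : ∀ m ≤ n, br σ m = br τ m := by
      intro m
      induction m with
      | zero => exact fun _ => rfl
      | succ m ih =>
        intro hm
        have h1 : σ m = τ m := not_not.1 (Nat.find_min hex (Nat.lt_of_succ_le hm))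
        change σ m :: br σ m = τ m :: br τ m
        rw [h1, ih (Nat.le_of_succ_le hm)]
    have hσ : x σ ∈ closure (P (T (br σ n)) (σ n)).1 := hx σ (n + 1)
    have hτ : x τ ∈ closure (P (T (br σ n)) (τ n)).1 := by
      rw [hlt n le_rfl]
      exact hx τ (n + 1)
    have hsmall := hc _ _ hστ (br σ n)
    have hn : σ n ≠ τ n := Nat.find_spec hex
    rcases hb : σ n with _ | _ <;> rcases hb' : τ n with _ | _
    · exact hn (hb.trans hb'.symm)
    · rw [hb] at hσ
      rw [hb'] at hτ
      exact lt_asymm hsmall (hPk _ _ hσ _ hτ)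
    · rw [hb] at hσ
      rw [hb'] at hτ
      rw [abs_sub_comm] at hsmall
      exact lt_asymm hsmall (hPk _ _ hτ _ hσ)
    · exact hn (hb.trans hb'.symm)
  classical
  exact Function.cantor_injective (fun s : Set ℕ => c (x fun n => decide (n ∈ s)))
    (hinj.comp fun s t h => Set.ext fun n => by simpa using congrFun h n)

/-! ### Weakly almost periodic functions are Asplund functions -/

/-- The pointwise closure of the right translates of `f`. -/
def rightHull {G : Type u} [Group G] (f : LInf G) : Set (G → ℝ) :=
  closure (Set.range fun h x => f (x * h))

theorem isCompact_rightHull {G : Type u} [Group G] (f : LInf G) : IsCompact (rightHull f) := by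
  obtain ⟨C, hC⟩ := (lp.memℓp f).bddAbove
  refine (isCompact_univ_pi fun _ : G => isCompact_Icc (a := -C) (b := C)).closure_of_subset ?_
  rintro _ ⟨h, rfl⟩ x -
  exact abs_le.1 (hC ⟨x * h, rfl⟩)

/-- The evaluation at a point, as an element of the weak dual of `ℓ^∞(G)`. -/
noncomputable def evalWeakDual {G : Type u} (h : G) : WeakDual ℝ (LInf G) :=
  StrongDual.toWeakDual (lp.evalCLM ℝ (fun _ : G => ℝ) (⊤ : ENNReal) h)

theorem evalWeakDual_apply {G : Type u} (h : G) (f : LInf G) : evalWeakDual h f = f h := rfl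

theorem isCompact_closure_range_evalWeakDual (G : Type u) :
    IsCompact (closure (Set.range (evalWeakDual (G := G)))) := by
  refine (WeakDual.isCompact_closedBall (0 : StrongDual ℝ (LInf G)) 1).closure_of_subset ?_
  rintro _ ⟨h, rfl⟩
  refine mem_closedBall_zero_iff.2 (ContinuousLinearMap.opNorm_le_bound _ zero_le_one fun f => ?_)
  rw [one_mul]
  exact lp.norm_apply_le_norm ENNReal.top_ne_zero f h

theorem continuous_weakSpace_eval {G : Type u} (φ : WeakDual ℝ (LInf G)) :
    Continuous fun k : WeakSpace ℝ (LInf G) => φ ((toWeakSpace ℝ (LInf G)).symm k) :=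
  WeakBilin.eval_continuous (topDualPairing ℝ (LInf G)).flip φ

theorem mem_closure_weakOrbit {G : Type u} [Group G] (f : LInf G) (x : G) :
    toWeakSpace ℝ (LInf G) (leftTranslate x f) ∈ closure (weakOrbit f) :=
  subset_closure ⟨x, rfl⟩

/-- The evaluation of right limits of `f` at weak limits of left translates of `f`. -/
theorem exists_separately_continuous_pairing {G : Type u} [Group G] (f : LInf G) :
    ∃ Ψ : rightHull f → closure (weakOrbit f) → ℝ, (∀ k, Continuous fun φ => Ψ φ k) ∧
      (∀ φ, Continuous (Ψ φ)) ∧ ∀ φ x, Ψ φ ⟨_, mem_closure_weakOrbit f x⟩ = φ.1 x := by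
  let B := closure (Set.range (evalWeakDual (G := G)))
  have hB : IsCompact B := isCompact_closure_range_evalWeakDual G
  have : CompactSpace B := isCompact_iff_compactSpace.1 hB
  let r : WeakDual ℝ (LInf G) → G → ℝ := fun φ x => φ (leftTranslate x f)
  have hr : Continuous r := continuous_pi fun x => WeakDual.eval_continuous _
  have hrB : r '' B = rightHull f := by
    have hrange : r '' Set.range evalWeakDual = Set.range fun h x => f (x * h) := by
      rw [← Set.range_comp]
      rfl
    refine subset_antisymm ?_ ?_
    · rw [rightHull, ← hrange]
      exact image_closure_subset_closure_image hr
    · refine closure_minimal ?_ (hB.image hr).isClosed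
      rw [← hrange]
      exact Set.image_mono subset_closure
  let q : B → rightHull f := fun φ => ⟨r φ, hrB ▸ Set.mem_image_of_mem r φ.2⟩
  have hqc : Continuous q := (hr.comp continuous_subtype_val).subtype_mk _
  have hqs : Function.Surjective q := by
    rintro ⟨y, hy⟩
    rw [← hrB] at hy
    obtain ⟨φ, hφ, rfl⟩ := hy
    exact ⟨⟨φ, hφ⟩, rfl⟩
  have hq : Topology.IsQuotientMap q := IsClosedMap.isQuotientMap hqc.isClosedMap hqc hqs
  -- Functionals with the same image under `q` agree on the orbit of `f`, hence on its weak closure,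
  -- being weakly continuous. This lets the pairing descend from `B` to the hull.
  have hfac : ∀ (k : closure (weakOrbit f)) (φ ψ : B), q φ = q ψ →
      φ.1 ((toWeakSpace ℝ (LInf G)).symm k) = ψ.1 ((toWeakSpace ℝ (LInf G)).symm k) := by
    intro k φ ψ h
    have : closure (weakOrbit f) ⊆ {k | φ.1 ((toWeakSpace ℝ (LInf G)).symm k) =
        ψ.1 ((toWeakSpace ℝ (LInf G)).symm k)} := closure_minimal (by
      rintro _ ⟨x, rfl⟩
      exact congrFun (congrArg Subtype.val h) x)
      (isClosed_eq (continuous_weakSpace_eval _) (continuous_weakSpace_eval _))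
    exact this k.2
  let s := Function.surjInv hqs
  have hs : ∀ φ, q (s φ) = φ := Function.surjInv_eq hqs
  refine ⟨fun φ k => (s φ).1 ((toWeakSpace ℝ (LInf G)).symm k), fun k => ?_, fun φ => ?_,
    fun φ x => ?_⟩
  · rw [hq.continuous_iff]
    convert (WeakDual.eval_continuous ((toWeakSpace ℝ (LInf G)).symm k.1)).comp
      (continuous_subtype_val (p := (· ∈ B))) using 1
    funext φ
    exact hfac k _ _ (hs _)
  · exact (continuous_weakSpace_eval _).comp continuous_subtype_val
  · exact congrFun (congrArg Subtype.val (hs φ)) x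

/-- Weak and pointwise topology agree on the weak closure of the orbit of `f`. -/
theorem IsWAP.continuous_orbit {G : Type u} [Group G] [TopologicalSpace G]
    [IsTopologicalGroup G] {f : LInf G} (hf : IsWAP f) :
    Continuous fun g : G =>
      (⟨_, mem_closure_weakOrbit f g⟩ : closure (weakOrbit f)) := by
  have : CompactSpace (closure (weakOrbit f)) := isCompact_iff_compactSpace.1 hf.2
  let e : closure (weakOrbit f) → G → ℝ := fun k h =>
    evalWeakDual h ((toWeakSpace ℝ (LInf G)).symm k.1)
  have he : Continuous e := continuous_pi fun h =>
    (continuous_weakSpace_eval _).comp continuous_subtype_val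
  have hinj : Function.Injective e := fun k l hkl => by
    have : (toWeakSpace ℝ (LInf G)).symm k.1 = (toWeakSpace ℝ (LInf G)).symm l.1 :=
      lp.ext (funext fun h => congrFun hkl h)
    exact Subtype.ext ((toWeakSpace ℝ (LInf G)).symm.injective this)
  rw [(he.isClosedEmbedding hinj).isInducing.continuous_iff]
  exact continuous_pi fun h => hf.1.comp (continuous_mul_const h)

/-- A weakly almost periodic function is uniformly continuous. -/
theorem IsWAP.eventually_translate_close {G : Type u} [Group G] [TopologicalSpace G]
    [IsTopologicalGroup G] {f : LInf G} (hf : IsWAP f) (g₁ : G) {ε : ℝ} (hε : 0 < ε) :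
    ∀ᶠ g in nhds g₁, ∀ φ ∈ rightHull f, |φ g - φ g₁| ≤ ε := by
  have hK : CompactSpace (closure (weakOrbit f)) := isCompact_iff_compactSpace.1 hf.2
  obtain ⟨Ψ, h₁, h₂, hΨ⟩ := exists_separately_continuous_pairing f
  have : CompactSpace (rightHull f) := isCompact_iff_compactSpace.1 (isCompact_rightHull f)
  have : Nonempty (closure (weakOrbit f)) := ⟨⟨_, mem_closure_weakOrbit f 1⟩⟩
  -- The weak orbit closure now plays the first factor, the hull the second.
  obtain ⟨O, hO, ⟨k, hk⟩, hOs⟩ := exists_isOpen_small_oscillation (Φ := fun k φ => Ψ φ k) h₂ h₁ hε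
  obtain ⟨O, hO', rfl⟩ := isOpen_induced_iff.1 hO
  obtain ⟨_, hgO, g₀, rfl⟩ := mem_closure_iff.1 k.2 O hO' hk
  have hev : ∀ᶠ g in nhds g₁, toWeakSpace ℝ (LInf G) (leftTranslate (g * (g₁⁻¹ * g₀)) f) ∈ O := by
    have hc : Continuous fun g : G => toWeakSpace ℝ (LInf G)
        (leftTranslate (g * (g₁⁻¹ * g₀)) f) :=
      (continuous_subtype_val.comp hf.continuous_orbit).comp (continuous_mul_const _)
    refine hc.continuousAt.eventually (hO'.mem_nhds ?_)
    simpa using hgO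
  filter_upwards [hev] with g hg
  have hbound : rightHull f ⊆ {φ | |φ g - φ g₁| ≤ ε} := by
    refine closure_minimal ?_ (isClosed_le
      ((continuous_apply g).sub (continuous_apply g₁)).abs continuous_const)
    rintro _ ⟨h, rfl⟩
    -- This right translate takes the value `f (g * h)` at `g * (g₁⁻¹ * g₀)` and `f (g₁ * h)` at
    -- `g₀`.
    have hφ : (fun x => f (x * (g₀⁻¹ * (g₁ * h)))) ∈ rightHull f := subset_closure ⟨_, rfl⟩
    have := hOs ⟨_, mem_closure_weakOrbit f (g * (g₁⁻¹ * g₀))⟩ hg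
      ⟨_, mem_closure_weakOrbit f g₀⟩ hgO ⟨_, hφ⟩
    rw [hΨ, hΨ] at this
    simpa [mul_assoc] using this
  exact fun φ hφ => hbound hφ

/-- The action of `G` on the closure of the right translates of `f`. -/
abbrev rightHullAction {G : Type u} [Group G] (f : LInf G) : MulAction G (rightHull f) where
  smul g φ := ⟨fun x => φ.1 (x * g), map_mem_closure (f := fun (φ : G → ℝ) x => φ (x * g))
    (continuous_pi fun x => continuous_apply _) φ.2 (by
      rintro _ ⟨h, rfl⟩
      exact ⟨g * h, funext fun x => by simp [mul_assoc]⟩)⟩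
  one_smul φ := Subtype.ext (funext fun x => congrArg φ.1 (mul_one x))
  mul_smul g h φ := Subtype.ext (funext fun x => congrArg φ.1 (mul_assoc x g h).symm)

/-- The function is recovered from the hull as evaluation at `1` along the orbit of `f` itself.
Nonsensitivity of a closed invariant subset is small oscillation of the pairing restricted to it. -/
theorem IsWAP.isAsplund {G : Type u} [Group G] [TopologicalSpace G] [IsTopologicalGroup G]
    {f : LInf G} (hf : IsWAP f) : IsAsplund (f : G → ℝ) := by
  let _ : MulAction G (rightHull f) := rightHullAction f
  have hcomp : CompactSpace (rightHull f) := isCompact_iff_compactSpace.1 (isCompact_rightHull f)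
  have hK : CompactSpace (closure (weakOrbit f)) := isCompact_iff_compactSpace.1 hf.2
  have hsmul : ContinuousSMul G (rightHull f) := by
    refine ⟨Continuous.subtype_mk (continuous_pi fun x => ?_) _⟩
    refine continuous_iff_continuousAt.2 fun ⟨g₁, φ₁⟩ => Metric.continuousAt_iff'.2 fun ε hε => ?_
    -- Uniformity over the whole hull is what turns separate continuity of the action into joint
    -- continuity.
    have h1 : ∀ᶠ p : G × rightHull f in nhds (g₁, φ₁),
        ∀ φ ∈ rightHull f, |φ (x * p.1) - φ (x * g₁)| ≤ ε / 2 :=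
      (Continuous.tendsto (f := fun p : G × rightHull f => x * p.1) (by fun_prop)
        (g₁, φ₁)).eventually (hf.eventually_translate_close (x * g₁) (half_pos hε))
    have h2 : ∀ᶠ p : G × rightHull f in nhds (g₁, φ₁),
        |p.2.1 (x * g₁) - φ₁.1 (x * g₁)| < ε / 2 := by
      have hc : Continuous fun p : G × rightHull f => |p.2.1 (x * g₁) - φ₁.1 (x * g₁)| :=
        (((continuous_apply (x * g₁)).comp (continuous_subtype_val.comp continuous_snd)).sub
          continuous_const).abs
      exact hc.continuousAt.eventually (gt_mem_nhds (by simpa using hε))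
    filter_upwards [h1, h2] with p hp1 hp2
    calc dist (p.2.1 (x * p.1)) (φ₁.1 (x * g₁))
        ≤ dist (p.2.1 (x * p.1)) (p.2.1 (x * g₁)) + dist (p.2.1 (x * g₁)) (φ₁.1 (x * g₁)) :=
          dist_triangle _ _ _
      _ < ε / 2 + ε / 2 := add_lt_add_of_le_of_lt (hp1 _ p.2.2) hp2
      _ = ε := add_halves ε
  refine ⟨rightHull f, inferInstance, hcomp, inferInstance, inferInstance, hsmul, ?_,
    ⟨fun φ => φ.1 1, (continuous_apply 1).comp continuous_subtype_val⟩,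
    ⟨f, subset_closure ⟨1, by simp⟩⟩, fun g => (congrArg f (one_mul g)).symm⟩
  intro Z hZ hne V hV
  rw [uniformity_subtype, Filter.mem_comap] at hV
  obtain ⟨V', hV', hsub'⟩ := hV
  rw [uniformity_subtype, Filter.mem_comap] at hV'
  obtain ⟨W, hW, hsub⟩ := hV'
  obtain ⟨ε, hε, hεW⟩ : ∃ ε > 0, ∀ u v : G → ℝ, (∀ x, |u x - v x| ≤ ε) → (u, v) ∈ W := by
    have h := UniformFun.uniformContinuous_toFun (α := G) (β := ℝ) hW
    rw [Filter.mem_map, (UniformFun.hasBasis_uniformity_of_basis G ℝ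
      Metric.uniformity_basis_dist_le).mem_iff] at h
    obtain ⟨ε, hε, h⟩ := h
    exact ⟨ε, hε, fun u v huv => h (show (UniformFun.ofFun u, UniformFun.ofFun v) ∈ _ from huv)⟩
  obtain ⟨Ψ, h₁, h₂, hΨ⟩ := exists_separately_continuous_pairing f
  have : CompactSpace Z := isCompact_iff_compactSpace.1 hZ.isCompact
  have : Nonempty Z := hne.to_subtype
  obtain ⟨O, hO, hOne, hOs⟩ := exists_isOpen_small_oscillation (Φ := fun (z : Z) k => Ψ z k)
    (fun k => (h₁ k).comp continuous_subtype_val) (fun z => h₂ z) hε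
  refine ⟨O, hO, hOne, fun g z hz w hw => hsub' (hsub (hεW _ _ fun x => ?_))⟩
  -- The value of `g • z` at `x` is that of `z` at `x * g`, so the bound over all parameters already
  -- covers all `g`.
  have := hOs z hz w hw ⟨_, mem_closure_weakOrbit f (x * g)⟩
  rw [hΨ, hΨ] at this
  exact this

theorem IsWAP.leftTranslate {G : Type u} [Group G] [TopologicalSpace G] [IsTopologicalGroup G]
    {f : LInf G} (hf : IsWAP f) (g : G) : IsWAP (leftTranslate g f) := by
  refine ⟨hf.1.comp (continuous_const_mul g), hf.2.of_isClosed_subset isClosed_closure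
    (closure_mono ?_)⟩
  rintro _ ⟨h, rfl⟩
  refine ⟨g * h, congrArg _ (lp.ext (funext fun x => ?_))⟩
  exact congrArg f (mul_assoc g h x)

end AsplundMean

theorem mainTheorem3 (G : Type u) [Group G] [TopologicalSpace G] [IsTopologicalGroup G] :
    AsplundMean.IsLeftAmenable (Subalgebra.toSubmodule (AsplundMean.Asp G)) ∧
    AsplundMean.WAP G ≤ Subalgebra.toSubmodule (AsplundMean.Asp G) ∧
    AsplundMean.IsLeftAmenable (AsplundMean.WAP G) := by
  have hle : AsplundMean.WAP G ≤ Subalgebra.toSubmodule (AsplundMean.Asp G) :=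
    fun _ hf => AsplundMean.IsWAP.isAsplund hf
  exact ⟨AsplundMean.isLeftAmenable_of_le_asp le_rfl fun g _ hf =>
      AsplundMean.IsAsplund.leftTranslate hf g,
    hle, AsplundMean.isLeftAmenable_of_le_asp hle fun g _ hf =>
      AsplundMean.IsWAP.leftTranslate hf g⟩
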